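/- **Compactifications.** Let $\mathsf{C}omp$ be the category whose objects are compactifications $e : X \to Y$, that is, topological embeddings with dense image of a completely regular (Hausdorff) space $X$ into a compact Hausdorff space $Y$. A morphism from $e : X \to Y$ to $e' : X' \to Y'$ is a pair $(f,g)$ of continuous maps $f : X \to X'$, $g : Y \to Y'$ with $g \circ e = e' \circ f$, and composition is componentwise. **De Vries algebras.** A de Vries algebra $\mathfrak A = (A,\prec)$ is a complete Boolean algebra $A$ with a binary relation $\prec$ such that: $1 \prec 1$; $a \prec b$ implies $a \le b$; $a \le b \prec c \le d$ implies $a \prec d$; $a \prec b$ and $a \prec c$ imply $a \prec b \wedge c$; $a \prec b$ implies $\neg b \prec \neg a$; $a \prec b$ implies that $a \prec c \prec b$ for some $c$; and $b \neq 0$ implies that $a \prec b$ for some $a \neq 0$. A de Vries morphism $\rho : \mathfrak A \to \mathfrak A'$ is a map such that $\rho(0) = 0$; $\rho(a \wedge b) = \rho(a) \wedge \rho(b)$; $a \prec b$ implies $\neg\rho(\neg a) \prec \rho(b)$; and $\rho(b) = \bigvee\{\rho(a) \mid a \prec b\}$. De Vries morphisms are composed by $(\rho_2 \star \rho_1)(b)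 = \bigvee \{\rho_2\rho_1(a) \mid a \prec b\}$. **De Vries extensions.** A de Vries extension is an injective de Vries morphism $\alpha : \mathfrak A \to \mathfrak B$, where $\mathfrak B = (B, \le)$ for a complete and atomic Boolean algebra $B$, such that each element of $B$ is a join of meets of elements of $\alpha[\mathfrak A]$. Let $\mathsf{DeVe}$ be the category of de Vries extensions. A morphism from $\alpha : \mathfrak A \to \mathfrak B$ to $\alpha' : \mathfrak A' \to \mathfrak B'$ is a pair $(\rho,\sigma)$ of a de Vries morphism $\rho : \mathfrak A \to \mathfrak A'$ and a complete Boolean homomorphism $\sigma : B \to B'$ with $\sigma \circ \alpha = \alpha' \star \rho$. Composition is $(\rho_2,\sigma_2)\circ(\rho_1,\sigma_1) = (\rho_2 \star \rho_1, \sigma_2 \circ \sigma_1)$. **The functor $\mathsf E$.** For a compact Hausdorff space $Y$, let $\mathcal{RO}(Y)$ be the de Vries algebra of regular open subsets of $Y$, with $U \prec V$ iff $\mathrm{cl}(U) \subseteq V$, and let $\wp(X)$ be the powerset of $X$ with proximity $\subseteq$. The contravariant functor $\mathsf E : \mathsf{C}omp \to \mathsf{DeVe}$ sends $e : X \to Y$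 to $e^{-1} : \mathcal{RO}(Y) \to \wp(X)$ and $(f,g)$ to $(g^*, f^{-1})$, where $g^*(U) = \mathrm{int}(\mathrm{cl}(g^{-1}(U)))$. **The functor $\mathsf C$.** For $S \subseteq \mathfrak A$ put $\Uparrow S = \{a \in \mathfrak A \mid b \prec a \text{ for some } b \in S\}$. An end of $\mathfrak A$ is a maximal element of the set of proper filters $F$ with $\Uparrow F = F$. Let $Y_{\mathfrak A}$ be the set of ends, with the topology that has the sets $\{y \mid a \in y\}$, $a \in \mathfrak A$, as a basis. For a de Vries morphism $\rho : \mathfrak A \to \mathfrak A'$ let $\rho_* : Y_{\mathfrak A'} \to Y_{\mathfrak A}$, $\rho_*(y) = \Uparrow \rho^{-1}(y)$. For a de Vries extension $\alpha : \mathfrak A \to \mathfrak B$ let $X_{\mathfrak B}$ be the set of atoms of $B$; identifying an atom $b$ with the end $\uparrow b$ of $\mathfrak B$, give $X_{\mathfrak B}$ the least topology making the restriction $\alpha_* : X_{\mathfrak B} \to Y_{\mathfrak A}$ continuous. For a complete Boolean homomorphism $\sigma : B \to B'$ let $\sigma_+ : X_{\mathfrak B'} \to X_{\mathfrak B}$,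 $\sigma_+(x) = \bigwedge\{b \in B \mid x \le \sigma(b)\}$. The contravariant functor $\mathsf C : \mathsf{DeVe} \to \mathsf{C}omp$ sends $\alpha : \mathfrak A \to \mathfrak B$ to $\alpha_* : X_{\mathfrak B} \to Y_{\mathfrak A}$ and $(\rho,\sigma)$ to $(\sigma_+, \rho_*)$. **Theorem.** The contravariant functors $\mathsf E$ and $\mathsf C$ form a dual equivalence between the category $\mathsf{C}omp$ of compactifications and the category $\mathsf{DeVe}$ of de Vries extensions. -/

import Mathlib

open CategoryTheory Set Topology

universe u

namespace DeVries

/-! ### De Vries algebras and de Vries morphisms -/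

/-- The axioms of a de Vries proximity on a Boolean algebra. -/
structure IsDeVriesProximity {A : Type u} [BooleanAlgebra A] (r : A → A → Prop) : Prop where
  top_top : r ⊤ ⊤
  le_of_prox : ∀ {a b : A}, r a b → a ≤ b
  mono : ∀ {a b c d : A}, a ≤ b → r b c → c ≤ d → r a d
  inf_right : ∀ {a b c : A}, r a b → r a c → r a (b ⊓ c)
  compl : ∀ {a b : A}, r a b → r bᶜ aᶜ
  interpolate : ∀ {a b : A}, r a b → ∃ c, r a c ∧ r c b
  exists_prox : ∀ {b : A}, b ≠ ⊥ → ∃ a, a ≠ ⊥ ∧ r a b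

/-- A de Vries algebra: a complete Boolean algebra with a de Vries proximity. -/
structure DeVriesAlgebra : Type (u + 1) where
  carrier : Type u
  [completeBooleanAlgebra : CompleteBooleanAlgebra carrier]
  prox : carrier → carrier → Prop
  isProx : IsDeVriesProximity prox

instance : CoeSort DeVriesAlgebra.{u} (Type u) := ⟨DeVriesAlgebra.carrier⟩

instance (A : DeVriesAlgebra.{u}) : CompleteBooleanAlgebra A := A.completeBooleanAlgebra

/-- The extremally disconnected de Vries algebra `(B, ≤)` of a complete Boolean algebra `B`. -/
abbrev extremallyDisconnected (B : Type u) [CompleteBooleanAlgebra B] : DeVriesAlgebra.{u} where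
  carrier := B
  prox := fun a b => a ≤ b
  isProx :=
    { top_top := le_rfl
      le_of_prox := fun h => h
      mono := fun h₁ h₂ h₃ => h₁.trans (h₂.trans h₃)
      inf_right := fun h₁ h₂ => le_inf h₁ h₂
      compl := fun h => compl_le_compl h
      interpolate := fun {a _} h => ⟨a, le_rfl, h⟩
      exists_prox := fun {b} h => ⟨b, h, le_rfl⟩ }

/-- De Vries morphisms. -/
@[ext]
structure DeVriesHom (A B : DeVriesAlgebra.{u}) : Type u where
  toFun : A → B
  map_bot : toFun ⊥ = ⊥
  map_inf : ∀ a b : A, toFun (a ⊓ b) = toFun a ⊓ toFun b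
  map_prox : ∀ a b : A, A.prox a b → B.prox (toFun aᶜ)ᶜ (toFun b)
  map_sSup : ∀ b : A, toFun b = sSup {x : B | ∃ a : A, A.prox a b ∧ toFun a = x}

instance (A B : DeVriesAlgebra.{u}) : CoeFun (DeVriesHom A B) (fun _ => A → B) :=
  ⟨DeVriesHom.toFun⟩

section

variable {A B C D : DeVriesAlgebra.{u}}

theorem prox_bot {a : A} (h : A.prox a ⊥) : a = ⊥ := le_bot_iff.1 (A.isProx.le_of_prox h)

theorem bot_prox (a : A) : A.prox ⊥ a := by
  have h := A.isProx.compl A.isProx.top_top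
  rw [compl_top] at h
  exact A.isProx.mono le_rfl h bot_le

theorem prox_top (a : A) : A.prox a ⊤ := A.isProx.mono le_top A.isProx.top_top le_rfl

theorem prox_inf_inf {a b c d : A} (h₁ : A.prox a b) (h₂ : A.prox c d) :
    A.prox (a ⊓ c) (b ⊓ d) :=
  A.isProx.inf_right (A.isProx.mono inf_le_left h₁ le_rfl)
    (A.isProx.mono inf_le_right h₂ le_rfl)

theorem prox_trans {a b c : A} (h₁ : A.prox a b) (h₂ : A.prox b c) : A.prox a c :=
  A.isProx.mono (A.isProx.le_of_prox h₁) h₂ le_rfl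

theorem eq_sSup_prox (b : A) : b = sSup {x : A | A.prox x b} := by
  apply le_antisymm
  · by_contra hlt
    have hne : b ⊓ (sSup {x : A | A.prox x b})ᶜ ≠ ⊥ := fun h =>
      hlt (by rwa [← disjoint_iff, disjoint_compl_right_iff] at h)
    obtain ⟨a, ha0, ha⟩ := A.isProx.exists_prox hne
    have h1 : A.prox a b := A.isProx.mono le_rfl ha inf_le_left
    have h2 : a ≤ sSup {x : A | A.prox x b} := le_sSup h1
    have h3 : a ≤ (sSup {x : A | A.prox x b})ᶜ := (A.isProx.le_of_prox ha).trans inf_le_right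
    exact ha0 (le_bot_iff.1 ((le_inf h2 h3).trans (inf_compl_eq_bot).le))
  · exact sSup_le fun x hx => A.isProx.le_of_prox hx

namespace DeVriesHom

theorem monotone (ρ : DeVriesHom A B) {a b : A} (h : a ≤ b) : ρ a ≤ ρ b := by
  have := ρ.map_inf a b
  rw [inf_eq_left.2 h] at this
  exact inf_eq_left.1 this.symm

theorem map_top (ρ : DeVriesHom A B) : ρ ⊤ = ⊤ := by
  have h := ρ.map_prox ⊤ ⊤ A.isProx.top_top
  rw [compl_top, ρ.map_bot, compl_bot] at h
  exact top_le_iff.1 (B.isProx.le_of_prox h)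

theorem map_le_compl (ρ : DeVriesHom A B) (a : A) : ρ a ≤ (ρ aᶜ)ᶜ := by
  rw [le_compl_iff_disjoint_right, disjoint_iff, ← ρ.map_inf, inf_compl_eq_bot, ρ.map_bot]

theorem prox_map (ρ : DeVriesHom A B) {a b : A} (h : A.prox a b) : B.prox (ρ a) (ρ b) :=
  B.isProx.mono (ρ.map_le_compl a) (ρ.map_prox a b h) le_rfl

end DeVriesHom

/-- The underlying function of the composition `ρ₂ ⋆ ρ₁` of de Vries morphisms. -/
def starFun (ρ₂ : DeVriesHom B C) (ρ₁ : DeVriesHom A B) (b : A) : C :=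
  sSup {x : C | ∃ a : A, A.prox a b ∧ ρ₂ (ρ₁ a) = x}

theorem le_starFun (ρ₂ : DeVriesHom B C) (ρ₁ : DeVriesHom A B) {a b : A} (h : A.prox a b) :
    ρ₂ (ρ₁ a) ≤ starFun ρ₂ ρ₁ b :=
  le_sSup ⟨a, h, rfl⟩

theorem starFun_le (ρ₂ : DeVriesHom B C) (ρ₁ : DeVriesHom A B) {b : A} {x : C}
    (h : ∀ a : A, A.prox a b → ρ₂ (ρ₁ a) ≤ x) : starFun ρ₂ ρ₁ b ≤ x :=
  sSup_le (by rintro _ ⟨a, ha, rfl⟩; exact h a ha)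

theorem starFun_le_comp (ρ₂ : DeVriesHom B C) (ρ₁ : DeVriesHom A B) (b : A) :
    starFun ρ₂ ρ₁ b ≤ ρ₂ (ρ₁ b) :=
  starFun_le _ _ fun _ ha => ρ₂.monotone (ρ₁.monotone (A.isProx.le_of_prox ha))

theorem starFun_mono (ρ₂ : DeVriesHom B C) (ρ₁ : DeVriesHom A B) {a b : A} (h : a ≤ b) :
    starFun ρ₂ ρ₁ a ≤ starFun ρ₂ ρ₁ b :=
  starFun_le _ _ fun _ hx => le_starFun _ _ (A.isProx.mono le_rfl hx h)

/-- The composition `ρ₂ ⋆ ρ₁` of de Vries morphisms. -/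
def star (ρ₂ : DeVriesHom B C) (ρ₁ : DeVriesHom A B) : DeVriesHom A C where
  toFun := starFun ρ₂ ρ₁
  map_bot := le_bot_iff.1 (starFun_le _ _ fun a ha => by
    rw [prox_bot ha, ρ₁.map_bot, ρ₂.map_bot])
  map_inf := fun a b => by
    apply le_antisymm
    · exact le_inf (starFun_mono _ _ inf_le_left) (starFun_mono _ _ inf_le_right)
    · rw [starFun, starFun, sSup_inf_sSup]
      refine iSup₂_le ?_
      rintro ⟨_, _⟩ ⟨⟨c, hc, rfl⟩, ⟨d, hd, rfl⟩⟩
      dsimp only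
      rw [← ρ₂.map_inf, ← ρ₁.map_inf]
      exact le_starFun _ _ (prox_inf_inf hc hd)
  map_prox := fun a b h => by
    obtain ⟨c, hac, hcb⟩ := A.isProx.interpolate h
    obtain ⟨d, hcd, hdb⟩ := A.isProx.interpolate hcb
    have h1 := ρ₂.map_prox _ _ (ρ₁.map_prox _ _ hcd)
    rw [compl_compl] at h1
    exact C.isProx.mono (compl_le_compl (le_starFun ρ₂ ρ₁ (A.isProx.compl hac))) h1
      (le_starFun ρ₂ ρ₁ hdb)
  map_sSup := fun b => by
    apply le_antisymm
    · refine starFun_le _ _ fun c hc => ?_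
      obtain ⟨d, hcd, hdb⟩ := A.isProx.interpolate hc
      exact (le_starFun ρ₂ ρ₁ hcd).trans (le_sSup ⟨d, hdb, rfl⟩)
    · refine sSup_le ?_
      rintro _ ⟨a, ha, rfl⟩
      exact starFun_mono _ _ (A.isProx.le_of_prox ha)

/-- The identity de Vries morphism. -/
def idHom (A : DeVriesAlgebra.{u}) : DeVriesHom A A where
  toFun := fun a => a
  map_bot := rfl
  map_inf := fun _ _ => rfl
  map_prox := fun a b h => by simpa using h
  map_sSup := fun b => by simpa using eq_sSup_prox b

theorem star_idHom (ρ : DeVriesHom A B) : star ρ (idHom A) = ρ :=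
  DeVriesHom.ext (funext fun b => (ρ.map_sSup b).symm)

theorem idHom_star (ρ : DeVriesHom A B) : star (idHom B) ρ = ρ :=
  DeVriesHom.ext (funext fun b => (ρ.map_sSup b).symm)

theorem star_assoc (ρ₃ : DeVriesHom C D) (ρ₂ : DeVriesHom B C) (ρ₁ : DeVriesHom A B) :
    star (star ρ₃ ρ₂) ρ₁ = star ρ₃ (star ρ₂ ρ₁) := by
  refine DeVriesHom.ext (funext fun b => le_antisymm ?_ ?_)
  · refine starFun_le _ _ fun a ha => ?_
    obtain ⟨c, hac, hcb⟩ := A.isProx.interpolate ha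
    refine le_trans (starFun_le_comp ρ₃ ρ₂ (ρ₁ a)) ?_
    exact (ρ₃.monotone (le_starFun ρ₂ ρ₁ hac)).trans (le_starFun ρ₃ (star ρ₂ ρ₁) hcb)
  · refine starFun_le _ _ fun a ha => ?_
    obtain ⟨c, hac, hcb⟩ := A.isProx.interpolate ha
    refine le_trans (ρ₃.monotone (starFun_le_comp ρ₂ ρ₁ a)) ?_
    exact (le_starFun ρ₃ ρ₂ (ρ₁.prox_map hac)).trans (le_starFun (star ρ₃ ρ₂) ρ₁ hcb)

end

/-! ### The category of de Vries extensions -/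

/-- A de Vries extension: an injective de Vries morphism `α : 𝔄 → (B, ≤)`, where `B` is a complete
and atomic Boolean algebra, such that every element of `B` is a join of meets of elements of the
image of `α`. -/
structure DeVriesExtension : Type (u + 1) where
  A : DeVriesAlgebra.{u}
  B : Type u
  [completeBooleanAlgebra : CompleteBooleanAlgebra B]
  [isAtomic : IsAtomic B]
  α : DeVriesHom A (extremallyDisconnected B)
  injective : Function.Injective α.toFun
  joinMeetDense : ∀ b : B, ∃ 𝒮 : Set (Set B),
    (∀ S ∈ 𝒮, S ⊆ Set.range α.toFun) ∧ b = sSup (sInf '' 𝒮)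

instance (a : DeVriesExtension.{u}) : CompleteBooleanAlgebra a.B := a.completeBooleanAlgebra

instance (a : DeVriesExtension.{u}) : IsAtomic a.B := a.isAtomic

namespace DeVriesExtension

/-- A morphism of de Vries extensions: a pair `(ρ, σ)` of a de Vries morphism and a complete Boolean
homomorphism with `σ ∘ α = α' ⋆ ρ`. (A map of complete Boolean algebras that preserves
arbitrary joins and meets also preserves complements.) -/
@[ext]
structure Hom (a a' : DeVriesExtension.{u}) : Type u where
  ρ : DeVriesHom a.A a'.A
  σ : CompleteLatticeHom a.B a'.B
  comm : ∀ x : a.A, σ (a.α x) = star a'.α ρ x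

/-- A complete homomorphism may be moved inside `⋆`. -/
theorem map_starFun {A A' : DeVriesAlgebra.{u}} {B B' : Type u} [CompleteBooleanAlgebra B]
    [CompleteBooleanAlgebra B'] (σ : CompleteLatticeHom B B')
    (α : DeVriesHom A' (extremallyDisconnected B)) (ρ : DeVriesHom A A') (x : A) :
    σ (starFun α ρ x) = sSup {y : B' | ∃ a : A, A.prox a x ∧ σ (α (ρ a)) = y} := by
  have h : σ (starFun α ρ x) = sSup (σ '' _) := sSupHomClass.map_sSup σ _
  rw [h]
  congr 1
  ext y
  constructor
  · rintro ⟨_, ⟨a, ha, rfl⟩, rfl⟩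
    exact ⟨a, ha, rfl⟩
  · rintro ⟨a, ha, rfl⟩
    exact ⟨_, ⟨a, ha, rfl⟩, rfl⟩

instance : Category DeVriesExtension.{u} where
  Hom := Hom
  id a :=
    { ρ := idHom a.A
      σ := CompleteLatticeHom.id a.B
      comm := fun x => by rw [star_idHom]; rfl }
  comp {a₁ a₂ a₃} φ ψ :=
    { ρ := star ψ.ρ φ.ρ
      σ := ψ.σ.comp φ.σ
      comm := fun x => by
        rw [← star_assoc]
        have h : ∀ y : a₂.A, ψ.σ (a₂.α y) = star a₃.α ψ.ρ y := ψ.comm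
        have h' : φ.σ (a₁.α x) = starFun a₂.α φ.ρ x := φ.comm x
        rw [CompleteLatticeHom.comp_apply, h', map_starFun]
        simp only [h]
        rfl }
  id_comp φ := Hom.ext (star_idHom _) rfl
  comp_id φ := Hom.ext (idHom_star _) rfl
  assoc φ ψ χ := Hom.ext (star_assoc _ _ _).symm rfl

end DeVriesExtension

/-! ### The category of compactifications -/

/-- A compactification `e : X → Y`: a dense embedding of a completely regular (Hausdorff) space `X`
into a compact Hausdorff space `Y`. -/
structure Compactification : Type (u + 1) where
  X : Type u
  Y : Type u
  [topX : TopologicalSpace X]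
  [topY : TopologicalSpace Y]
  [completelyRegular : T35Space X]
  [compact : CompactSpace Y]
  [hausdorff : T2Space Y]
  e : X → Y
  isEmbedding : IsEmbedding e
  denseRange : DenseRange e

namespace Compactification

instance (e : Compactification.{u}) : TopologicalSpace e.X := e.topX
instance (e : Compactification.{u}) : TopologicalSpace e.Y := e.topY
instance (e : Compactification.{u}) : T35Space e.X := e.completelyRegular
instance (e : Compactification.{u}) : CompactSpace e.Y := e.compact
instance (e : Compactification.{u}) : T2Space e.Y := e.hausdorff

/-- A morphism of compactifications: a pair `(f, g)` of continuous maps with `g ∘ e = e' ∘ f`. -/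
@[ext]
structure Hom (e e' : Compactification.{u}) : Type u where
  f : C(e.X, e'.X)
  g : C(e.Y, e'.Y)
  comm : ∀ x : e.X, g (e.e x) = e'.e (f x)

instance : Category Compactification.{u} where
  Hom := Hom
  id e :=
    { f := ContinuousMap.id e.X
      g := ContinuousMap.id e.Y
      comm := fun _ => rfl }
  comp φ ψ :=
    { f := ψ.f.comp φ.f
      g := ψ.g.comp φ.g
      comm := fun x => by
        change ψ.g (φ.g _) = _
        rw [φ.comm, ψ.comm]
        rfl }

end Compactification

/-! ### Regular open sets -/

/-- The regular open subsets of a space: those that are the interior of their closure. -/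
@[ext]
structure RO (Y : Type u) [TopologicalSpace Y] : Type u where
  carrier : Set Y
  regular : interior (closure carrier) = carrier

namespace RO

section

variable {Y : Type u} [TopologicalSpace Y]

theorem isOpen (U : RO Y) : IsOpen U.carrier := by
  rw [← U.regular]
  exact isOpen_interior

theorem interior_closure_idem (s : Set Y) :
    interior (closure (interior (closure s))) = interior (closure s) := by
  apply Subset.antisymm
  · exact interior_mono (closure_minimal interior_subset isClosed_closure)
  · exact interior_maximal subset_closure isOpen_interior

theorem subset_interior_closure {s : Set Y} (hs : IsOpen s) : s ⊆ interior (closure s) :=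
  interior_maximal subset_closure hs

/-- The regular open set `int (cl s)`. -/
def reg (s : Set Y) : RO Y := ⟨interior (closure s), interior_closure_idem s⟩

theorem reg_mono {s t : Set Y} (h : s ⊆ t) : (reg s).carrier ⊆ (reg t).carrier :=
  interior_mono (closure_mono h)

theorem reg_subset {s : Set Y} {U : RO Y} (h : s ⊆ U.carrier) : (reg s).carrier ⊆ U.carrier := by
  have := reg_mono h
  rwa [show (reg U.carrier).carrier = U.carrier from U.regular] at this

theorem interior_closure_inter {s t : Set Y} (hs : IsOpen s) (_ht : IsOpen t) :
    interior (closure (s ∩ t)) = interior (closure s) ∩ interior (closure t) := by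
  apply Subset.antisymm
  · exact subset_inter (interior_mono (closure_mono inter_subset_left))
      (interior_mono (closure_mono inter_subset_right))
  · refine interior_maximal ?_ (isOpen_interior.inter isOpen_interior)
    have h1 : interior (closure s) ∩ interior (closure t) ⊆
        closure (s ∩ interior (closure t)) := fun x hx =>
      (isOpen_interior.closure_inter) ⟨interior_subset hx.1, hx.2⟩
    have h2 : s ∩ interior (closure t) ⊆ closure (s ∩ t) := fun x hx =>
      hs.inter_closure ⟨hx.1, interior_subset hx.2⟩
    exact h1.trans (closure_minimal h2 isClosed_closure)

instance : PartialOrder (RO Y) := PartialOrder.lift RO.carrier (fun _ _ h => RO.ext h)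

theorem le_def {U V : RO Y} : U ≤ V ↔ U.carrier ⊆ V.carrier := Iff.rfl

instance : Max (RO Y) := ⟨fun U V => reg (U.carrier ∪ V.carrier)⟩

instance : Min (RO Y) := ⟨fun U V => ⟨U.carrier ∩ V.carrier, by
  rw [interior_closure_inter U.isOpen V.isOpen, U.regular, V.regular]⟩⟩

instance : SupSet (RO Y) := ⟨fun S => reg (⋃ U ∈ S, U.carrier)⟩

instance : InfSet (RO Y) := ⟨fun S => ⟨interior (⋂ U ∈ S, U.carrier), by
  apply Subset.antisymm
  · refine interior_maximal ?_ isOpen_interior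
    refine subset_iInter₂ fun U hU => ?_
    refine reg_subset (U := U) ?_
    exact interior_subset.trans (iInter₂_subset U hU)
  · exact subset_interior_closure isOpen_interior⟩⟩

instance : Compl (RO Y) := ⟨fun U => ⟨interior U.carrierᶜ, by
  have h : IsClosed U.carrierᶜ := U.isOpen.isClosed_compl
  have := interior_closure_idem U.carrierᶜ
  rwa [h.closure_eq] at this⟩⟩

instance : Top (RO Y) := ⟨⟨univ, by simp⟩⟩

instance : Bot (RO Y) := ⟨⟨∅, by simp⟩⟩

theorem carrier_sup (U V : RO Y) :
    (U ⊔ V).carrier = interior (closure (U.carrier ∪ V.carrier)) := rfl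

theorem carrier_inf (U V : RO Y) : (U ⊓ V).carrier = U.carrier ∩ V.carrier := rfl

theorem carrier_compl (U : RO Y) : Uᶜ.carrier = interior U.carrierᶜ := rfl

theorem carrier_sSup (S : Set (RO Y)) :
    (sSup S).carrier = interior (closure (⋃ U ∈ S, U.carrier)) := rfl

theorem carrier_sInf (S : Set (RO Y)) : (sInf S).carrier = interior (⋂ U ∈ S, U.carrier) := rfl

theorem carrier_top : (⊤ : RO Y).carrier = univ := rfl

theorem carrier_bot : (⊥ : RO Y).carrier = ∅ := rfl

instance : CompleteBooleanAlgebra (RO Y) where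
  sup := (· ⊔ ·)
  inf := (· ⊓ ·)
  le_sup_left U V := subset_union_left.trans
    (subset_interior_closure (U.isOpen.union V.isOpen))
  le_sup_right U V := subset_union_right.trans
    (subset_interior_closure (U.isOpen.union V.isOpen))
  sup_le U V W hU hV := reg_subset (union_subset hU hV)
  inf_le_left U V := inter_subset_left
  inf_le_right U V := inter_subset_right
  le_inf U V W hV hW := subset_inter hV hW
  isLUB_sSup S := by
    constructor
    · intro U hU
      refine (subset_biUnion_of_mem (u := RO.carrier) hU).trans ?_
      exact subset_interior_closure (isOpen_biUnion fun U _ => U.isOpen)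
    · intro V hV
      exact reg_subset (iUnion₂_subset fun U hU => hV hU)
  isGLB_sInf S := by
    constructor
    · intro U hU
      exact interior_subset.trans (iInter₂_subset U hU)
    · intro V hV
      exact interior_maximal (subset_iInter₂ fun U hU => hV hU) V.isOpen
  le_top U := subset_univ _
  bot_le U := empty_subset _
  le_sup_inf U V W := by
    change interior (closure (U.carrier ∪ V.carrier)) ∩ interior (closure (U.carrier ∪ W.carrier))
      ⊆ interior (closure (U.carrier ∪ (V.carrier ∩ W.carrier)))
    rw [← interior_closure_inter (U.isOpen.union V.isOpen) (U.isOpen.union W.isOpen),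
      ← union_inter_distrib_left]
  inf_compl_le_bot U := fun x hx => (interior_subset hx.2 : x ∈ U.carrierᶜ) hx.1
  top_le_sup_compl U := by
    change univ ⊆ interior (closure (U.carrier ∪ interior U.carrierᶜ))
    have : closure (U.carrier ∪ interior U.carrierᶜ) = univ := by
      rw [closure_union, interior_compl, eq_univ_iff_forall]
      intro x
      by_cases hx : x ∈ closure U.carrier
      · exact Or.inl hx
      · exact Or.inr (subset_closure hx)
    rw [this, interior_univ]

end

section

variable {Y : Type u} [TopologicalSpace Y] [CompactSpace Y] [T2Space Y]

theorem exists_mem_closure_subset {y : Y} {O : Set Y} (hO : IsOpen O) (hy : y ∈ O) :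
    ∃ V : RO Y, y ∈ V.carrier ∧ closure V.carrier ⊆ O := by
  obtain ⟨t, ht, htc, hts⟩ := exists_mem_nhds_isClosed_subset (hO.mem_nhds hy)
  refine ⟨reg (interior t), ?_, ?_⟩
  · exact subset_interior_closure isOpen_interior (mem_interior_iff_mem_nhds.2 ht)
  · refine (closure_minimal ?_ htc).trans hts
    exact interior_subset.trans (closure_minimal interior_subset htc)

theorem isDeVriesProximity :
    IsDeVriesProximity (fun U V : RO Y => closure U.carrier ⊆ V.carrier) where
  top_top := subset_univ _
  le_of_prox h := subset_closure.trans h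
  mono h₁ h₂ h₃ := (closure_mono h₁).trans (h₂.trans h₃)
  inf_right h₁ h₂ := subset_inter h₁ h₂
  compl {U V} h := by
    change closure (interior V.carrierᶜ) ⊆ interior U.carrierᶜ
    rw [interior_compl (s := U.carrier)]
    exact (closure_minimal interior_subset V.isOpen.isClosed_compl).trans
      (compl_subset_compl.2 h)
  interpolate {U V} h := by
    obtain ⟨O, hO, hUO, hOV⟩ := normal_exists_closure_subset isClosed_closure V.isOpen h
    refine ⟨reg O, hUO.trans (subset_interior_closure hO), ?_⟩
    exact (closure_minimal interior_subset isClosed_closure).trans hOV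
  exists_prox {V} h := by
    have hne : V.carrier.Nonempty := by
      rw [nonempty_iff_ne_empty]
      exact fun h' => h (RO.ext h')
    obtain ⟨y, hy⟩ := hne
    obtain ⟨U, hyU, hUV⟩ := exists_mem_closure_subset V.isOpen hy
    refine ⟨U, fun h' => ?_, hUV⟩
    rw [h'] at hyU
    exact hyU

end

end RO

/-- The de Vries algebra `Y^* = (RO(Y), ≺)` of regular open subsets of a compact Hausdorff space, with
the canonical proximity: `U ≺ V` iff the closure of `U` is contained in `V`. -/
abbrev upperStar (Y : Type u) [TopologicalSpace Y] [CompactSpace Y] [T2Space Y] :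
    DeVriesAlgebra.{u} where
  carrier := RO Y
  prox := fun U V => closure U.carrier ⊆ V.carrier
  isProx := RO.isDeVriesProximity

section

variable {Y Y' : Type u} [TopologicalSpace Y] [TopologicalSpace Y']

theorem preimage_subset_reg (g : C(Y, Y')) (U : RO Y') :
    g ⁻¹' U.carrier ⊆ (RO.reg (g ⁻¹' U.carrier)).carrier :=
  RO.subset_interior_closure (U.isOpen.preimage g.continuous)

theorem reg_preimage_subset (g : C(Y, Y')) {U : RO Y'} {s : Set Y'} (h : closure U.carrier ⊆ s) :
    (RO.reg (g ⁻¹' U.carrier)).carrier ⊆ g ⁻¹' s := by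
  refine interior_subset.trans ?_
  refine (closure_minimal ?_ (isClosed_closure.preimage g.continuous)).trans (preimage_mono h)
  exact preimage_mono subset_closure

end

section

variable {Y Y' Y'' : Type u} [TopologicalSpace Y] [CompactSpace Y] [T2Space Y]
  [TopologicalSpace Y'] [CompactSpace Y'] [T2Space Y']
  [TopologicalSpace Y''] [CompactSpace Y''] [T2Space Y'']

/-- The de Vries morphism `g^* : RO(Y') → RO(Y)`, `g^* U = int (cl (g⁻¹ U))`, dual to a continuous map
`g : Y → Y'`. -/
def upperStarMap (g : C(Y, Y')) : DeVriesHom (upperStar Y') (upperStar Y) where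
  toFun := fun U : RO Y' => RO.reg (g ⁻¹' U.carrier)
  map_bot := RO.ext (by
    change interior (closure (g ⁻¹' ∅)) = ∅
    simp)
  map_inf := fun U V : RO Y' => RO.ext
    (RO.interior_closure_inter (U.isOpen.preimage g.continuous) (V.isOpen.preimage g.continuous))
  map_prox := fun (U V : RO Y') (h : closure U.carrier ⊆ V.carrier) => by
    change closure (interior (RO.reg (g ⁻¹' (interior U.carrierᶜ))).carrierᶜ) ⊆
      (RO.reg (g ⁻¹' V.carrier)).carrier
    refine (closure_minimal interior_subset (RO.isOpen _).isClosed_compl).trans ?_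
    have h1 := preimage_subset_reg g Uᶜ
    refine (compl_subset_compl.2 h1).trans ?_
    rw [RO.carrier_compl, interior_compl, preimage_compl, compl_compl]
    exact (preimage_mono h).trans (preimage_subset_reg g V)
  map_sSup := fun V : RO Y' => by
    apply le_antisymm
    · refine RO.reg_subset ?_
      intro y hy
      obtain ⟨U, hU, hUV⟩ := RO.exists_mem_closure_subset V.isOpen hy
      have hle : (RO.reg (g ⁻¹' U.carrier)) ≤
          sSup {x : RO Y | ∃ a : RO Y', closure a.carrier ⊆ V.carrier ∧
            RO.reg (g ⁻¹' a.carrier) = x} := le_sSup ⟨U, hUV, rfl⟩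
      exact hle (preimage_subset_reg g U hU)
    · refine sSup_le ?_
      rintro _ ⟨U, hU, rfl⟩
      exact RO.reg_mono (preimage_mono (subset_closure.trans hU))

theorem upperStarMap_id : upperStarMap (ContinuousMap.id Y) = idHom (upperStar Y) :=
  DeVriesHom.ext (funext fun U : RO Y => RO.ext U.regular)

theorem upperStarMap_comp (g : C(Y, Y')) (h : C(Y', Y'')) :
    upperStarMap (h.comp g) = star (upperStarMap g) (upperStarMap h) := by
  refine DeVriesHom.ext (funext fun U : RO Y'' => le_antisymm ?_ ?_)
  · refine RO.reg_subset ?_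
    intro y hy
    obtain ⟨V, hV, hVU⟩ := RO.exists_mem_closure_subset U.isOpen hy
    have hle := le_starFun (upperStarMap g) (upperStarMap h) (a := V) (b := U) hVU
    refine (RO.le_def.1 hle) ?_
    refine preimage_subset_reg g (RO.reg (h ⁻¹' V.carrier)) ?_
    exact preimage_subset_reg h V hV
  · refine starFun_le _ _ fun (V : RO Y'') (hV : closure V.carrier ⊆ U.carrier) => ?_
    exact RO.reg_mono (preimage_mono (reg_preimage_subset h hV))

end

/-! ### The functor `E` -/

/-- The de Vries morphism `e⁻¹ : RO(Y) → ℘(X)` of a compactification `e : X → Y`. -/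
def preimageHom (e : Compactification.{u}) :
    DeVriesHom (upperStar e.Y) (extremallyDisconnected (Set e.X)) where
  toFun := fun U : RO e.Y => e.e ⁻¹' U.carrier
  map_bot := rfl
  map_inf := fun _ _ => rfl
  map_prox := fun (U V : RO e.Y) (h : closure U.carrier ⊆ V.carrier) => by
    change (e.e ⁻¹' (interior U.carrierᶜ))ᶜ ⊆ e.e ⁻¹' V.carrier
    rw [interior_compl, preimage_compl, compl_compl]
    exact preimage_mono h
  map_sSup := fun V : RO e.Y => by
    apply le_antisymm
    · intro x hx
      obtain ⟨U, hU, hUV⟩ := RO.exists_mem_closure_subset V.isOpen hx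
      exact ⟨e.e ⁻¹' U.carrier, ⟨U, hUV, rfl⟩, hU⟩
    · refine sSup_le ?_
      rintro _ ⟨U, hU, rfl⟩
      exact preimage_mono (subset_closure.trans hU)

/-- The de Vries extension `e⁻¹ : RO(Y) → ℘(X)` of a compactification `e : X → Y`. -/
def EObj (e : Compactification.{u}) : DeVriesExtension.{u} where
  A := upperStar e.Y
  B := Set e.X
  α := preimageHom e
  injective := by
    intro (U : RO e.Y) (V : RO e.Y) (h : e.e ⁻¹' U.carrier = e.e ⁻¹' V.carrier)
    have key : ∀ W : RO e.Y,
        W.carrier = interior (closure (e.e '' (e.e ⁻¹' W.carrier))) := fun W => by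
      have h1 : closure (e.e '' (e.e ⁻¹' W.carrier)) = closure W.carrier := by
        rw [image_preimage_eq_inter_range]
        apply Subset.antisymm (closure_mono inter_subset_left)
        refine closure_minimal ?_ isClosed_closure
        have hd : Dense (Set.range e.e) := e.denseRange
        exact hd.open_subset_closure_inter W.isOpen
      rw [h1, W.regular]
    exact RO.ext (by rw [key U, key V, h])
  joinMeetDense := fun s => by
    let S : e.X → Set (Set e.X) := fun x =>
      {t | x ∈ t ∧ ∃ U : RO e.Y, e.e ⁻¹' U.carrier = t}
    refine ⟨S '' s, ?_, ?_⟩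
    · rintro _ ⟨x, -, rfl⟩ t ⟨-, U, rfl⟩
      exact ⟨U, rfl⟩
    · have hS : ∀ x, sInf (S x) = {x} := fun x => by
        apply Subset.antisymm
        · intro x' hx'
          by_contra hne
          have hne' : e.e x ∈ ({e.e x'} : Set e.Y)ᶜ := fun h =>
            hne (e.isEmbedding.injective h).symm
          obtain ⟨U, hU, hU'⟩ :=
            RO.exists_mem_closure_subset isClosed_singleton.isOpen_compl hne'
          exact hU' (subset_closure (hx' _ ⟨hU, U, rfl⟩)) rfl
        · rintro _ rfl t ht
          exact ht.1
      rw [image_image]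
      simp [hS]

/-- The morphism `(g^*, f⁻¹)` of de Vries extensions. -/
def EMap {e e' : Compactification.{u}} (φ : Compactification.Hom e e') :
    DeVriesExtension.Hom (EObj e') (EObj e) where
  ρ := upperStarMap φ.g
  σ := CompleteLatticeHom.setPreimage φ.f
  comm := fun U : RO e'.Y => by
    have hcomm : φ.f ⁻¹' (e'.e ⁻¹' U.carrier) = e.e ⁻¹' (φ.g ⁻¹' U.carrier) := by
      ext x
      simp only [mem_preimage, φ.comm]
    change φ.f ⁻¹' (e'.e ⁻¹' U.carrier) = starFun (preimageHom e) (upperStarMap φ.g) U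
    rw [hcomm]
    apply le_antisymm
    · intro x hx
      obtain ⟨V, hV, hVU⟩ := RO.exists_mem_closure_subset U.isOpen hx
      have hle := le_starFun (preimageHom e) (upperStarMap φ.g) (a := V) (b := U) hVU
      exact hle (preimage_subset_reg φ.g V hV)
    · refine starFun_le _ _ fun (V : RO e'.Y) (hV : closure V.carrier ⊆ U.carrier) => ?_
      exact preimage_mono (reg_preimage_subset φ.g hV)

/-- The contravariant functor `E`, sending `e : X → Y` to `e⁻¹ : RO(Y) → ℘(X)` and `(f, g)` to
`(g^*, f⁻¹)`. -/
def E : Compactification.{u}ᵒᵖ ⥤ DeVriesExtension.{u} where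
  obj e := EObj e.unop
  map φ := EMap φ.unop
  map_id _ := DeVriesExtension.Hom.ext upperStarMap_id rfl
  map_comp φ ψ := DeVriesExtension.Hom.ext (upperStarMap_comp ψ.unop.g φ.unop.g) rfl

/-! ### Ends -/

/-- `⇑ S`, the set of elements having some element of `S` proximal to them. -/
def upProx (A : DeVriesAlgebra.{u}) (S : Set A) : Set A := {a | ∃ b ∈ S, A.prox b a}

/-- A proper round filter of a de Vries algebra. -/
structure IsProperRoundFilter (A : DeVriesAlgebra.{u}) (F : Set A) : Prop where
  top_mem : ⊤ ∈ F
  inf_mem : ∀ {a b : A}, a ∈ F → b ∈ F → a ⊓ b ∈ F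
  mem_of_le : ∀ {a b : A}, a ∈ F → a ≤ b → b ∈ F
  bot_notMem : ⊥ ∉ F
  round : upProx A F = F

/-- An end: a maximal proper round filter. -/
def IsEnd (A : DeVriesAlgebra.{u}) (F : Set A) : Prop := Maximal (IsProperRoundFilter A) F

/-- The set `Y_𝔄` of ends of `𝔄`. -/
def Ends (A : DeVriesAlgebra.{u}) : Type u := {F : Set A // IsEnd A F}

/-- `ζ(a)`, the set of ends that contain `a`. -/
def zeta (A : DeVriesAlgebra.{u}) (a : A) : Set (Ends A) := {x | a ∈ x.1}

/-- The topology on the set of ends that has the sets `ζ(a)` as a basis (they are closed under finite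
intersections). -/
instance (A : DeVriesAlgebra.{u}) : TopologicalSpace (Ends A) :=
  TopologicalSpace.generateFrom (Set.range (zeta A))

section

variable {A B C : DeVriesAlgebra.{u}}

theorem IsProperRoundFilter.exists_prox {F : Set A} (hF : IsProperRoundFilter A F) {a : A}
    (ha : a ∈ F) : ∃ b ∈ F, A.prox b a := by
  rw [← hF.round] at ha
  exact ha

theorem IsProperRoundFilter.notMem_compl {F : Set A} (hF : IsProperRoundFilter A F) {a : A}
    (ha : a ∈ F) : aᶜ ∉ F := fun h => hF.bot_notMem (by
  have := hF.inf_mem ha h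
  rwa [inf_compl_eq_bot] at this)

/-- A proper round filter containing `¬ a` or `b` whenever `a ≺ b` is an end. -/
theorem isEnd_of_prime {F : Set A} (hF : IsProperRoundFilter A F)
    (h : ∀ a b : A, A.prox a b → aᶜ ∈ F ∨ b ∈ F) : IsEnd A F := by
  refine ⟨hF, fun G hG hFG x hx => ?_⟩
  obtain ⟨y, hy, hyx⟩ := hG.exists_prox hx
  rcases h y x hyx with h1 | h1
  · exact absurd (hFG h1) (hG.notMem_compl hy)
  · exact h1

theorem IsEnd.prime {F : Set A} (hF : IsEnd A F) {a b : A} (hab : A.prox a b) :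
    aᶜ ∈ F ∨ b ∈ F := by
  by_contra hcon
  rw [not_or] at hcon
  obtain ⟨hna, hnb⟩ := hcon
  let G : Set A := {x | ∃ f ∈ F, ∃ d, A.prox a d ∧ f ⊓ d ≤ x}
  have hG : IsProperRoundFilter A G :=
    { top_mem := ⟨⊤, hF.1.top_mem, ⊤, prox_top a, le_top⟩
      inf_mem := by
        rintro x y ⟨f, hf, d, hd, hx⟩ ⟨f', hf', d', hd', hy⟩
        refine ⟨f ⊓ f', hF.1.inf_mem hf hf', d ⊓ d', A.isProx.inf_right hd hd', ?_⟩
        rw [inf_inf_inf_comm]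
        exact inf_le_inf hx hy
      mem_of_le := by
        rintro x y ⟨f, hf, d, hd, hx⟩ hxy
        exact ⟨f, hf, d, hd, hx.trans hxy⟩
      bot_notMem := by
        rintro ⟨f, hf, d, hd, hx⟩
        have hfd : f ≤ dᶜ := by
          rw [le_compl_iff_disjoint_right, disjoint_iff]
          exact le_bot_iff.1 hx
        exact hna (hF.1.mem_of_le hf
          (hfd.trans (A.isProx.le_of_prox (A.isProx.compl hd))))
      round := by
        apply Subset.antisymm
        · rintro y ⟨x, ⟨f, hf, d, hd, hx⟩, hxy⟩
          exact ⟨f, hf, d, hd, hx.trans (A.isProx.le_of_prox hxy)⟩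
        · rintro x ⟨f, hf, d, hd, hx⟩
          obtain ⟨f', hf', hff⟩ := hF.1.exists_prox hf
          obtain ⟨d', had, hdd⟩ := A.isProx.interpolate hd
          exact ⟨f' ⊓ d', ⟨f', hf', d', had, le_rfl⟩,
            A.isProx.mono le_rfl (prox_inf_inf hff hdd) hx⟩ }
  have hFG : F ≤ G := fun f hf => ⟨f, hf, ⊤, prox_top a, inf_le_left⟩
  exact hnb (hF.2 hG hFG ⟨⊤, hF.1.top_mem, b, hab, inf_le_right⟩)

theorem Ends.eq_of_subset {x y : Ends A} (h : x.1 ⊆ y.1) : x = y :=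
  Subtype.ext (Subset.antisymm h (x.2.2 y.2.1 h))

theorem isOpen_zeta (a : A) : IsOpen (zeta A a) :=
  TopologicalSpace.isOpen_generateFrom_of_mem ⟨a, rfl⟩

theorem zeta_mono {a b : A} (h : a ≤ b) : zeta A a ⊆ zeta A b :=
  fun x hx => x.2.1.mem_of_le hx h

instance (A : DeVriesAlgebra.{u}) : CompactSpace (Ends A) := by
  refine ⟨isCompact_iff_ultrafilter_le_nhds.2 fun 𝒰 _ => ?_⟩
  let F : Set A := {a | ∃ b, A.prox b a ∧ zeta A b ∈ 𝒰}
  have hF : IsProperRoundFilter A F :=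
    { top_mem := by
        refine ⟨⊤, A.isProx.top_top, ?_⟩
        have : zeta A ⊤ = univ := eq_univ_of_forall fun x => x.2.1.top_mem
        rw [this]
        exact Filter.univ_mem
      inf_mem := by
        rintro x y ⟨b, hb, hb'⟩ ⟨c, hc, hc'⟩
        refine ⟨b ⊓ c, prox_inf_inf hb hc, Filter.mem_of_superset (Filter.inter_mem hb' hc') ?_⟩
        exact fun z hz => z.2.1.inf_mem hz.1 hz.2
      mem_of_le := by
        rintro x y ⟨b, hb, hb'⟩ hxy
        exact ⟨b, A.isProx.mono le_rfl hb hxy, hb'⟩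
      bot_notMem := by
        rintro ⟨b, hb, hb'⟩
        obtain ⟨z, hz⟩ := 𝒰.nonempty_of_mem hb'
        rw [prox_bot hb] at hz
        exact z.2.1.bot_notMem hz
      round := by
        apply Subset.antisymm
        · rintro y ⟨x, ⟨b, hb, hb'⟩, hxy⟩
          exact ⟨b, prox_trans hb hxy, hb'⟩
        · rintro x ⟨b, hb, hb'⟩
          obtain ⟨c, hbc, hcx⟩ := A.isProx.interpolate hb
          exact ⟨c, ⟨b, hbc, hb'⟩, hcx⟩ }
  have hend : IsEnd A F := by
    refine isEnd_of_prime hF fun a b hab => ?_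
    obtain ⟨c, hac, hcb⟩ := A.isProx.interpolate hab
    obtain ⟨d, hcd, hdb⟩ := A.isProx.interpolate hcb
    have hcov : zeta A cᶜ ∪ zeta A d ∈ 𝒰 := by
      have : zeta A cᶜ ∪ zeta A d = univ := eq_univ_of_forall fun x => x.2.prime hcd
      rw [this]
      exact Filter.univ_mem
    rcases Ultrafilter.union_mem_iff.1 hcov with h | h
    · exact Or.inl ⟨cᶜ, A.isProx.compl hac, h⟩
    · exact Or.inr ⟨d, hdb, h⟩
  let z : Ends A := ⟨F, hend⟩
  refine ⟨z, mem_univ _, ?_⟩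
  rw [TopologicalSpace.nhds_generateFrom]
  refine le_iInf₂ ?_
  rintro s ⟨hs, ⟨a, rfl⟩⟩
  obtain ⟨b, hb, hb'⟩ : a ∈ F := hs
  exact Filter.le_principal_iff.2 (Filter.mem_of_superset hb' (zeta_mono (A.isProx.le_of_prox hb)))

instance (A : DeVriesAlgebra.{u}) : T2Space (Ends A) := by
  refine ⟨fun x y hxy => ?_⟩
  have hns : ¬ x.1 ⊆ y.1 := fun h => hxy (Ends.eq_of_subset h)
  obtain ⟨a, hax, hay⟩ := not_subset.1 hns
  obtain ⟨b, hbx, hba⟩ := x.2.1.exists_prox hax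
  rcases y.2.prime hba with h | h
  · refine ⟨zeta A b, zeta A bᶜ, isOpen_zeta b, isOpen_zeta _, hbx, h, ?_⟩
    rw [disjoint_left]
    exact fun z hz hz' => z.2.1.notMem_compl hz hz'
  · exact absurd h hay

theorem isEnd_upProx (ρ : DeVriesHom A B) (y : Ends B) :
    IsEnd A (upProx A (ρ.toFun ⁻¹' y.1)) := by
  have hF : IsProperRoundFilter A (upProx A (ρ.toFun ⁻¹' y.1)) :=
    { top_mem := ⟨⊤, by rw [mem_preimage, ρ.map_top]; exact y.2.1.top_mem, A.isProx.top_top⟩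
      inf_mem := by
        rintro a b ⟨c, hc, hca⟩ ⟨d, hd, hdb⟩
        refine ⟨c ⊓ d, ?_, prox_inf_inf hca hdb⟩
        rw [mem_preimage, ρ.map_inf]
        exact y.2.1.inf_mem hc hd
      mem_of_le := by
        rintro a b ⟨c, hc, hca⟩ hab
        exact ⟨c, hc, A.isProx.mono le_rfl hca hab⟩
      bot_notMem := by
        rintro ⟨c, hc, hc0⟩
        rw [prox_bot hc0, mem_preimage, ρ.map_bot] at hc
        exact y.2.1.bot_notMem hc
      round := by
        apply Subset.antisymm
        · rintro b ⟨a, ⟨c, hc, hca⟩, hab⟩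
          exact ⟨c, hc, prox_trans hca hab⟩
        · rintro a ⟨c, hc, hca⟩
          obtain ⟨d, hcd, hda⟩ := A.isProx.interpolate hca
          exact ⟨d, ⟨c, hc, hcd⟩, hda⟩ }
  refine isEnd_of_prime hF fun a b hab => ?_
  obtain ⟨c, hac, hcb⟩ := A.isProx.interpolate hab
  obtain ⟨d, hcd, hdb⟩ := A.isProx.interpolate hcb
  rcases y.2.prime (ρ.map_prox c d hcd) with h | h
  · rw [compl_compl] at h
    exact Or.inl ⟨cᶜ, h, A.isProx.compl hac⟩
  · exact Or.inr ⟨d, h, hdb⟩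

/-- The map `ρ_* : Y_𝔅 → Y_𝔄`, `ρ_* y = ⇑ ρ⁻¹(y)`, dual to a de Vries morphism `ρ : 𝔄 → 𝔅`. -/
def lowerStar (ρ : DeVriesHom A B) (y : Ends B) : Ends A :=
  ⟨upProx A (ρ.toFun ⁻¹' y.1), isEnd_upProx ρ y⟩

theorem continuous_lowerStar (ρ : DeVriesHom A B) : Continuous (lowerStar ρ) := by
  refine continuous_generateFrom_iff.2 ?_
  rintro _ ⟨a, rfl⟩
  have : lowerStar ρ ⁻¹' zeta A a = ⋃ b ∈ {b : A | A.prox b a}, zeta B (ρ b) := by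
    ext y
    simp only [mem_iUnion]
    constructor
    · rintro ⟨b, hb, hba⟩
      exact ⟨b, hba, hb⟩
    · rintro ⟨b, hba, hb⟩
      exact ⟨b, hb, hba⟩
  rw [this]
  exact isOpen_biUnion fun b _ => isOpen_zeta _

theorem lowerStar_idHom (y : Ends A) : lowerStar (idHom A) y = y :=
  Subtype.ext y.2.1.round

theorem lowerStar_star (ρ₂ : DeVriesHom B C) (ρ₁ : DeVriesHom A B) (y : Ends C) :
    lowerStar (star ρ₂ ρ₁) y = lowerStar ρ₁ (lowerStar ρ₂ y) := by
  refine (Ends.eq_of_subset ?_).symm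
  rintro a ⟨b, ⟨c, hc, hcb⟩, hba⟩
  obtain ⟨d, hbd, hda⟩ := A.isProx.interpolate hba
  refine ⟨d, y.2.1.mem_of_le hc ?_, hda⟩
  exact (ρ₂.monotone (B.isProx.le_of_prox hcb)).trans (le_starFun ρ₂ ρ₁ hbd)

end

/-! ### The functor `C` -/

section

variable {B B' B'' : Type u} [CompleteBooleanAlgebra B] [CompleteBooleanAlgebra B']
  [CompleteBooleanAlgebra B'']

theorem atom_le_or_le_compl {x : B} (hx : IsAtom x) (b : B) : x ≤ b ∨ x ≤ bᶜ := by
  by_cases h : x ≤ b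
  · exact Or.inl h
  · exact Or.inr (le_compl_iff_disjoint_right.2 (hx.not_le_iff_disjoint.1 h))

theorem isEnd_atom {x : B} (hx : IsAtom x) : IsEnd (extremallyDisconnected B) (Set.Ici x) := by
  refine isEnd_of_prime
    { top_mem := le_top (a := x)
      inf_mem := fun ha hb => le_inf (α := B) ha hb
      mem_of_le := fun ha hab => le_trans (α := B) ha hab
      bot_notMem := fun h => hx.1 (le_bot_iff.1 h)
      round := ?_ } ?_
  · apply Subset.antisymm
    · rintro b ⟨a, ha, hab⟩
      exact le_trans (α := B) ha hab
    · exact fun b hb => ⟨b, hb, le_refl (α := B) b⟩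
  · intro (a : B) (b : B) (hab : a ≤ b)
    rcases atom_le_or_le_compl hx a with h | h
    · exact Or.inr (h.trans hab)
    · exact Or.inl h

/-- The principal ultrafilter `↑x` of an atom `x`, as an end of `(B, ≤)`. -/
def atomEnd (x : {x : B // IsAtom x}) : Ends (extremallyDisconnected B) :=
  ⟨Set.Ici x.1, isEnd_atom x.2⟩

theorem le_map_sInf (σ : CompleteLatticeHom B B') (x : B') :
    x ≤ σ (sInf {b : B | x ≤ σ b}) := by
  rw [map_sInf]
  refine le_sInf ?_
  rintro _ ⟨b, hb, rfl⟩
  exact hb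

theorem sInf_le_iff_le_map (σ : CompleteLatticeHom B B') (x : B') (b : B) :
    sInf {b : B | x ≤ σ b} ≤ b ↔ x ≤ σ b :=
  ⟨fun h => (le_map_sInf σ x).trans (OrderHomClass.mono σ h), fun h => sInf_le h⟩

theorem isAtom_sInf (σ : CompleteLatticeHom B B') {x : B'} (hx : IsAtom x) :
    IsAtom (sInf {b : B | x ≤ σ b}) := by
  constructor
  · intro h
    have := le_map_sInf σ x
    rw [h, map_bot] at this
    exact hx.1 (le_bot_iff.1 this)
  · intro c hc
    rcases atom_le_or_le_compl hx (σ c) with h | h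
    · exact absurd ((sInf_le_iff_le_map σ x c).2 h) hc.not_ge
    · rw [← map_compl'] at h
      have h1 := hc.le.trans ((sInf_le_iff_le_map σ x cᶜ).2 h)
      rw [le_compl_iff_disjoint_right, disjoint_self] at h1
      exact h1

/-- The map `σ_+` from the atoms of `B'` to the atoms of `B`, `σ_+ x = ⋀ {b | x ≤ σ b}`, dual to a
complete Boolean homomorphism `σ : B → B'`. -/
def lowerPlus (σ : CompleteLatticeHom B B') (x : {x : B' // IsAtom x}) : {x : B // IsAtom x} :=
  ⟨sInf {b : B | x.1 ≤ σ b}, isAtom_sInf σ x.2⟩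

end

namespace DeVriesExtension

/-- The set `X_𝔅` of atoms of `B`, for a de Vries extension `α : 𝔄 → 𝔅 = (B, ≤)`. -/
def AtomSpace (a : DeVriesExtension.{u}) : Type u := {x : a.B // IsAtom x}

/-- The restriction of `α_*` to the atoms. -/
def atomMap (a : DeVriesExtension.{u}) (x : a.AtomSpace) : Ends a.A := lowerStar a.α (atomEnd x)

/-- The least topology on the set of atoms that makes `α_*` continuous. -/
instance (a : DeVriesExtension.{u}) : TopologicalSpace a.AtomSpace :=
  TopologicalSpace.induced a.atomMap inferInstance

theorem mem_atomMap (a : DeVriesExtension.{u}) (x : a.AtomSpace) (b : a.A) :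
    b ∈ (a.atomMap x).1 ↔ x.1 ≤ a.α b := by
  constructor
  · rintro ⟨c, hc, hcb⟩
    exact le_trans (α := a.B) hc (a.α.monotone (a.A.isProx.le_of_prox hcb))
  · intro h
    by_contra hcon
    have hle : a.α b ≤ x.1ᶜ := by
      rw [a.α.map_sSup b]
      refine sSup_le (α := a.B) ?_
      rintro _ ⟨c, hc, rfl⟩
      rcases atom_le_or_le_compl x.2 (a.α c) with h' | h'
      · exact (hcon ⟨c, h', hc⟩).elim
      · exact le_compl_comm.1 h'
    have h1 : x.1 ≤ x.1ᶜ := le_trans (α := a.B) h hle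
    rw [le_compl_iff_disjoint_right, disjoint_self] at h1
    exact x.2.1 h1

theorem atomMap_injective (a : DeVriesExtension.{u}) : Function.Injective a.atomMap := by
  intro x y hxy
  have key : ∀ b : a.A, x.1 ≤ a.α b → y.1 ≤ a.α b := fun b hb => by
    rw [← mem_atomMap, ← hxy, mem_atomMap]
    exact hb
  obtain ⟨𝒮, h𝒮, hx⟩ := a.joinMeetDense x.1
  have hex : ∃ S ∈ 𝒮, x.1 ≤ sInf S := by
    by_contra hcon
    have hle : x.1 ≤ x.1ᶜ := by
      refine hx.le.trans (sSup_le ?_)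
      rintro _ ⟨S, hS, rfl⟩
      rcases atom_le_or_le_compl x.2 (sInf S) with h | h
      · exact absurd ⟨S, hS, h⟩ hcon
      · exact le_compl_comm.1 h
    rw [le_compl_iff_disjoint_right, disjoint_self] at hle
    exact x.2.1 hle
  obtain ⟨S, hS, hxS⟩ := hex
  have hyS : y.1 ≤ sInf S := le_sInf fun s hs => by
    obtain ⟨b, rfl⟩ := h𝒮 S hS hs
    exact key b (hxS.trans (sInf_le hs))
  have hSx : sInf S ≤ x.1 := le_trans (le_sSup (mem_image_of_mem _ hS)) hx.ge
  have hyx : y.1 ≤ x.1 := hyS.trans hSx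
  exact Subtype.ext (((x.2.le_iff).1 hyx).resolve_left y.2.1).symm

theorem isEmbedding_atomMap (a : DeVriesExtension.{u}) : IsEmbedding a.atomMap :=
  ⟨⟨rfl⟩, a.atomMap_injective⟩

theorem isTopologicalBasis_zeta (A : DeVriesAlgebra.{u}) :
    TopologicalSpace.IsTopologicalBasis (Set.range (zeta A)) where
  exists_subset_inter := by
    rintro _ ⟨a, rfl⟩ _ ⟨b, rfl⟩ x hx
    refine ⟨zeta A (a ⊓ b), ⟨_, rfl⟩, x.2.1.inf_mem hx.1 hx.2, ?_⟩
    exact subset_inter (zeta_mono inf_le_left) (zeta_mono inf_le_right)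
  sUnion_eq := eq_univ_of_forall fun x => ⟨zeta A ⊤, ⟨_, rfl⟩, x.2.1.top_mem⟩
  eq_generateFrom := rfl

theorem denseRange_atomMap (a : DeVriesExtension.{u}) : DenseRange a.atomMap := by
  refine (isTopologicalBasis_zeta a.A).dense_iff.2 ?_
  rintro _ ⟨b, rfl⟩ ⟨y, hy⟩
  have hb : a.α b ≠ (⊥ : a.B) := fun h => by
    have h0 : b = ⊥ := a.injective (h.trans a.α.map_bot.symm)
    rw [h0] at hy
    exact y.2.1.bot_notMem hy
  obtain ⟨x, hx, hxb⟩ := (IsAtomic.eq_bot_or_exists_atom_le (a.α b : a.B)).resolve_left hb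
  exact ⟨a.atomMap ⟨x, hx⟩, (a.mem_atomMap ⟨x, hx⟩ b).2 hxb, ⟨x, hx⟩, rfl⟩

instance (a : DeVriesExtension.{u}) : T35Space a.AtomSpace := a.isEmbedding_atomMap.t35Space

end DeVriesExtension

/-- The compactification `α_* : X_𝔅 → Y_𝔄` of a de Vries extension `α : 𝔄 → 𝔅`. -/
def CObj (a : DeVriesExtension.{u}) : Compactification.{u} where
  X := a.AtomSpace
  Y := Ends a.A
  e := a.atomMap
  isEmbedding := a.isEmbedding_atomMap
  denseRange := a.denseRange_atomMap

theorem atomMap_lowerPlus {a a' : DeVriesExtension.{u}} (φ : DeVriesExtension.Hom a a')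
    (x : a'.AtomSpace) : lowerStar φ.ρ (a'.atomMap x) = a.atomMap (lowerPlus φ.σ x) := by
  have h : lowerStar φ.ρ (a'.atomMap x) = lowerStar (star a'.α φ.ρ) (atomEnd x) :=
    (lowerStar_star a'.α φ.ρ (atomEnd x)).symm
  rw [h]
  refine Ends.eq_of_subset ?_
  rintro b ⟨c, hc, hcb⟩
  refine ⟨c, ?_, hcb⟩
  change x.1 ≤ star a'.α φ.ρ c at hc
  rw [← φ.comm c] at hc
  exact (sInf_le_iff_le_map φ.σ x.1 (a.α c)).2 hc

/-- The morphism `(σ_+, ρ_*)` of compactifications. -/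
def CMap {a a' : DeVriesExtension.{u}} (φ : DeVriesExtension.Hom a a') :
    Compactification.Hom (CObj a') (CObj a) where
  f := ⟨(lowerPlus φ.σ : a'.AtomSpace → a.AtomSpace), by
    refine continuous_induced_rng.2 ?_
    have hc : Continuous (lowerStar φ.ρ ∘ a'.atomMap) :=
      (continuous_lowerStar φ.ρ).comp continuous_induced_dom
    exact hc.congr fun x => atomMap_lowerPlus φ x⟩
  g := ⟨lowerStar φ.ρ, continuous_lowerStar φ.ρ⟩
  comm := fun x => atomMap_lowerPlus φ x

/-- The contravariant functor `C`, sending `α : 𝔄 → 𝔅` to `α_* : X_𝔅 → Y_𝔄` and `(ρ, σ)` to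
`(σ_+, ρ_*)`. -/
def C : DeVriesExtension.{u}ᵒᵖ ⥤ Compactification.{u} where
  obj a := CObj a.unop
  map φ := CMap φ.unop
  map_id a := by
    refine Compactification.Hom.ext (ContinuousMap.ext fun x => ?_)
      (ContinuousMap.ext fun y => lowerStar_idHom y)
    exact Subtype.ext (le_antisymm (sInf_le (le_refl x.1)) (le_sInf fun _ hb => hb))
  map_comp {a₁ a₂ a₃} φ ψ := by
    refine Compactification.Hom.ext (ContinuousMap.ext fun x => ?_)
      (ContinuousMap.ext fun y => lowerStar_star φ.unop.ρ ψ.unop.ρ y)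
    refine Subtype.ext ?_
    change sInf {b | x.1 ≤ φ.unop.σ (ψ.unop.σ b)} =
      sInf {b | sInf {c | x.1 ≤ φ.unop.σ c} ≤ ψ.unop.σ b}
    simp only [sInf_le_iff_le_map]

end DeVries

/-!
Both composites of `E` and `C` are naturally isomorphic to identities. On the algebraic side,
`a ↦ ζ(a)` represents a de Vries algebra as the regular open sets of its space of ends: the `ζ(a)`
are a basis of regular open sets, so that `𝔄` is join-dense, and by complements also meet-dense, in
`RO(Y_𝔄)`; as both are complete they agree, and compactness of `Y_𝔄` matches the proximities.
Together with the representation of a complete atomic Boolean algebra as the powerset of its atoms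
this gives `α ≅ E(C(α))`. On the topological side, a point of a compact Hausdorff space `Y`
corresponds to the end of its regular open neighbourhoods. These ends are dense in `Y_{RO(Y)}`, so
compactness of `Y` makes the correspondence a homeomorphism; with points of `X` as singleton
atoms this gives `e ≅ C(E(e))`.
-/

namespace DeVries

theorem surjective_of_map_compl_of_isLUB {A L : Type*} [CompleteBooleanAlgebra A]
    [BooleanAlgebra L] (f : A ↪o L) (map_compl : ∀ a, f aᶜ = (f a)ᶜ)
    (isLUB : ∀ u, IsLUB {v ∈ range f | v ≤ u} u) : Function.Surjective f := by
  intro u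
  refine ⟨sSup {a | f a ≤ u}, le_antisymm ?_ ?_⟩
  · -- Join-density at `uᶜ` is meet-density at `u`.
    rw [← compl_le_compl_iff_le, ← map_compl]
    refine (isLUB uᶜ).2 ?_
    rintro _ ⟨⟨c, rfl⟩, hc⟩
    refine f.monotone (le_compl_comm.1 (sSup_le fun a (ha : f a ≤ u) => ?_))
    rw [← f.le_iff_le, map_compl]
    exact ha.trans (le_compl_comm.1 hc)
  · refine (isLUB u).2 ?_
    rintro _ ⟨⟨a, rfl⟩, ha⟩
    exact f.monotone (le_sSup ha)

/-! ### Existence of ends -/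

section

variable {A : DeVriesAlgebra.{u}}

theorem sup_prox {a b c : A} (h₁ : A.prox a c) (h₂ : A.prox b c) : A.prox (a ⊔ b) c := by
  have h := A.isProx.compl (A.isProx.inf_right (A.isProx.compl h₁) (A.isProx.compl h₂))
  simpa only [compl_inf, compl_compl] using h

theorem le_iff_forall_prox {a b : A} : a ≤ b ↔ ∀ c, A.prox c a → A.prox c b := by
  refine ⟨fun hab c hca => A.isProx.mono le_rfl hca hab, fun h => ?_⟩
  rw [eq_sSup_prox a]
  exact sSup_le fun c hca => A.isProx.le_of_prox (h c hca)

theorem isProperRoundFilter_sUnion {c : Set (Set A)} (hc : ∀ F ∈ c, IsProperRoundFilter A F)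
    (hdir : DirectedOn (· ⊆ ·) c) (hne : c.Nonempty) : IsProperRoundFilter A (⋃₀ c) where
  top_mem := hne.elim fun F hF => ⟨F, hF, (hc F hF).top_mem⟩
  inf_mem := by
    rintro a b ⟨F, hF, ha⟩ ⟨G, hG, hb⟩
    obtain ⟨H, hH, hFH, hGH⟩ := hdir F hF G hG
    exact ⟨H, hH, (hc H hH).inf_mem (hFH ha) (hGH hb)⟩
  mem_of_le := fun ⟨F, hF, ha⟩ hab => ⟨F, hF, (hc F hF).mem_of_le ha hab⟩
  bot_notMem := fun ⟨F, hF, h⟩ => (hc F hF).bot_notMem h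
  round := by
    apply Subset.antisymm
    · rintro b ⟨a, ⟨F, hF, ha⟩, hab⟩
      exact ⟨F, hF, (hc F hF).mem_of_le ha (A.isProx.le_of_prox hab)⟩
    · rintro b ⟨F, hF, hb⟩
      obtain ⟨a, ha, hab⟩ := (hc F hF).exists_prox hb
      exact ⟨a, ⟨F, hF, ha⟩, hab⟩

theorem isProperRoundFilter_upProx {S : Set A} (hne : S.Nonempty) (hdir : DirectedOn (· ≥ ·) S)
    (hbot : ⊥ ∉ S) : IsProperRoundFilter A (upProx A S) where
  top_mem := hne.elim fun c hc => ⟨c, hc, prox_top c⟩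
  inf_mem := by
    rintro a b ⟨c, hc, hca⟩ ⟨d, hd, hdb⟩
    obtain ⟨m, hm, hmc, hmd⟩ := hdir c hc d hd
    exact ⟨m, hm, A.isProx.mono (le_inf hmc hmd) (prox_inf_inf hca hdb) le_rfl⟩
  mem_of_le := fun ⟨c, hc, hca⟩ hab => ⟨c, hc, A.isProx.mono le_rfl hca hab⟩
  bot_notMem := fun ⟨c, hc, hc0⟩ => hbot (prox_bot hc0 ▸ hc)
  round := by
    apply Subset.antisymm
    · rintro b ⟨a, ⟨c, hc, hca⟩, hab⟩
      exact ⟨c, hc, prox_trans hca hab⟩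
    · rintro a ⟨c, hc, hca⟩
      obtain ⟨d, hcd, hda⟩ := A.isProx.interpolate hca
      exact ⟨d, ⟨c, hc, hcd⟩, hda⟩

theorem IsProperRoundFilter.exists_end_superset {F : Set A} (hF : IsProperRoundFilter A F) :
    ∃ y : Ends A, F ⊆ y.1 := by
  obtain ⟨m, hFm, hm⟩ := zorn_subset_nonempty {G | IsProperRoundFilter A G}
    (fun c hcS hc hne => ⟨⋃₀ c, isProperRoundFilter_sUnion hcS hc.directedOn hne,
      fun _ => subset_sUnion_of_mem⟩) F hF
  exact ⟨⟨m, hm⟩, hFm⟩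

theorem zeta_nonempty {a : A} (ha : a ≠ ⊥) : (zeta A a).Nonempty := by
  obtain ⟨c, hc, hca⟩ := A.isProx.exists_prox ha
  obtain ⟨y, hy⟩ := (isProperRoundFilter_upProx (singleton_nonempty c)
    (directedOn_singleton c) hc.symm).exists_end_superset
  exact ⟨y, hy ⟨c, rfl, hca⟩⟩

end

/-! ### The representation of a de Vries algebra by regular open sets of ends -/

section

variable {A A' : DeVriesAlgebra.{u}}

theorem zeta_inf (a b : A) : zeta A (a ⊓ b) = zeta A a ∩ zeta A b :=
  Subset.antisymm (subset_inter (zeta_mono inf_le_left) (zeta_mono inf_le_right))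
    fun y hy => y.2.1.inf_mem hy.1 hy.2

theorem zeta_inter_zeta_nonempty {a b : A} : (zeta A a ∩ zeta A b).Nonempty ↔ ¬ a ≤ bᶜ := by
  rw [← zeta_inf, le_compl_iff_disjoint_right, disjoint_iff]
  refine ⟨?_, zeta_nonempty⟩
  rintro ⟨y, hy⟩ h
  exact y.2.1.bot_notMem (h ▸ hy)

theorem zeta_subset_zeta_iff {a b : A} : zeta A a ⊆ zeta A b ↔ a ≤ b := by
  refine ⟨fun h => ?_, zeta_mono⟩
  by_contra hab
  obtain ⟨y, hya, hyb⟩ := zeta_inter_zeta_nonempty.2 ((compl_compl b).symm ▸ hab)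
  exact y.2.1.notMem_compl (h hya) hyb

theorem exists_mem_zeta_subset {y : Ends A} {O : Set (Ends A)} (hO : IsOpen O) (hy : y ∈ O) :
    ∃ a, y ∈ zeta A a ∧ zeta A a ⊆ O := by
  obtain ⟨_, ⟨a, rfl⟩, ha, haO⟩ :=
    (DeVriesExtension.isTopologicalBasis_zeta A).exists_subset_of_mem_open hy hO
  exact ⟨a, ha, haO⟩

theorem closure_zeta (a : A) : closure (zeta A a) = (zeta A aᶜ)ᶜ := by
  apply Subset.antisymm
  · exact closure_minimal (fun y hy => y.2.1.notMem_compl hy) (isOpen_zeta _).isClosed_compl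
  · refine fun y hy => (DeVriesExtension.isTopologicalBasis_zeta A).mem_closure_iff.2 ?_
    rintro _ ⟨b, rfl⟩ hyb
    exact zeta_inter_zeta_nonempty.2 fun hba => hy (zeta_mono hba hyb)

theorem interior_closure_zeta (a : A) : interior (closure (zeta A a)) = zeta A a := by
  rw [closure_zeta, interior_compl, closure_zeta, compl_compl, compl_compl]

theorem closure_zeta_subset_zeta_iff {a b : A} : closure (zeta A a) ⊆ zeta A b ↔ A.prox a b := by
  constructor
  · intro h
    have : Nonempty {c : A // A.prox c b} := ⟨⟨⊥, bot_prox b⟩⟩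
    -- By roundness `ζ(b)` is the directed union of the `ζ(c)` with `c ≺ b`.
    obtain ⟨⟨c, hcb⟩, hc⟩ := isClosed_closure.isCompact.elim_directed_cover
      (fun c : {c : A // A.prox c b} => zeta A c.1) (fun c => isOpen_zeta c.1)
      (fun y hy => by
        obtain ⟨c, hc, hcb⟩ := y.2.1.exists_prox (h hy)
        exact mem_iUnion.2 ⟨⟨c, hcb⟩, hc⟩)
      (fun c d => ⟨⟨c.1 ⊔ d.1, sup_prox c.2 d.2⟩, zeta_mono le_sup_left, zeta_mono le_sup_right⟩)
    exact A.isProx.mono (zeta_subset_zeta_iff.1 (subset_closure.trans hc)) hcb le_rfl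
  · intro h y hy
    rw [closure_zeta] at hy
    exact (y.2.prime h).resolve_left hy

/-- The embedding `a ↦ ζ(a)` of a de Vries algebra into the regular open sets of its space of ends,
as a map of Boolean algebras; the proximities are compared in `zetaIso`. -/
def zetaEmbedding (A : DeVriesAlgebra.{u}) : A ↪o RO (Ends A) :=
  OrderEmbedding.ofMapLEIff (fun a => ⟨zeta A a, interior_closure_zeta a⟩)
    fun _ _ => zeta_subset_zeta_iff

theorem zetaEmbedding_compl (a : A) : zetaEmbedding A aᶜ = (zetaEmbedding A a)ᶜ := by
  refine RO.ext ?_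
  change zeta A aᶜ = interior (zeta A a)ᶜ
  rw [interior_compl, closure_zeta, compl_compl]

theorem isLUB_zetaEmbedding (U : RO (Ends A)) : IsLUB {V ∈ range (zetaEmbedding A) | V ≤ U} U := by
  refine ⟨fun V hV => hV.2, fun W hW y hy => ?_⟩
  obtain ⟨a, hya, haU⟩ := exists_mem_zeta_subset U.isOpen hy
  exact hW ⟨mem_range_self a, haU⟩ hya

theorem zetaEmbedding_surjective : Function.Surjective (zetaEmbedding A) :=
  surjective_of_map_compl_of_isLUB _ zetaEmbedding_compl isLUB_zetaEmbedding

/-- The representation `a ↦ ζ(a)` of a de Vries algebra `𝔄` as `RO(Y_𝔄)`. An isomorphism of de Vries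
algebras is encoded as an isomorphism of proximity relations, which determine the orders. -/
noncomputable def zetaIso (A : DeVriesAlgebra.{u}) : A.prox ≃r (upperStar (Ends A)).prox where
  toEquiv := Equiv.ofBijective (zetaEmbedding A)
    ⟨(zetaEmbedding A).injective, zetaEmbedding_surjective⟩
  map_rel_iff' := closure_zeta_subset_zeta_iff

/-- The map `ρ_* : Y_𝔄' → Y_𝔄` dual to a de Vries morphism `ρ : 𝔄 → 𝔄'`, as a continuous map,
to which `g ↦ g^*` applies. -/
abbrev lowerStarMap (ρ : DeVriesHom A A') : C(Ends A', Ends A) :=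
  ⟨lowerStar ρ, continuous_lowerStar ρ⟩

theorem upperStarMap_lowerStarMap_zetaIso (ρ : DeVriesHom A A') (a : A) :
    upperStarMap (lowerStarMap ρ) (zetaIso A a) = zetaIso A' (ρ a) := by
  apply le_antisymm
  · refine RO.reg_subset ?_
    rintro y ⟨b, hb, hba⟩
    exact y.2.1.mem_of_le hb (ρ.monotone (A.isProx.le_of_prox hba))
  · obtain ⟨c, hc⟩ := zetaEmbedding_surjective (RO.reg (lowerStar ρ ⁻¹' zeta A a))
    suffices h : ρ a ≤ c from ((zetaEmbedding A').monotone h).trans hc.le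
    rw [ρ.map_sSup a]
    refine sSup_le ?_
    rintro _ ⟨b, hba, rfl⟩
    have hb : zeta A' (ρ b) ⊆ lowerStar ρ ⁻¹' zeta A a := fun y hy => ⟨b, hy, hba⟩
    rw [← (zetaEmbedding A').le_iff_le, hc]
    exact hb.trans (preimage_subset_reg (lowerStarMap ρ) (zetaEmbedding A a))

end

/-! ### Isomorphisms of de Vries algebras and of de Vries extensions -/

section

variable {A A' A'' : DeVriesAlgebra.{u}}

/-- The order isomorphism underlying an isomorphism of de Vries algebras. -/
def orderIsoOfProxIso (θ : A.prox ≃r A'.prox) : A ≃o A' where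
  toEquiv := θ.toEquiv
  map_rel_iff' {a b} := by
    change θ a ≤ θ b ↔ a ≤ b
    simp only [le_iff_forall_prox, θ.surjective.forall, θ.map_rel_iff]

namespace DeVriesHom

/-- An isomorphism of de Vries algebras, as a de Vries morphism. -/
def ofProxIso (θ : A.prox ≃r A'.prox) : DeVriesHom A A' where
  toFun := orderIsoOfProxIso θ
  map_bot := OrderIso.map_bot _
  map_inf := OrderIso.map_inf _
  map_prox := fun a b h => by
    rw [map_compl', compl_compl]
    exact θ.map_rel_iff.2 h
  map_sSup := fun b => by
    conv_lhs => rw [eq_sSup_prox b, sSupHomClass.map_sSup]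
    rfl

theorem star_ofProxIso (ρ : DeVriesHom A' A'') (θ : A.prox ≃r A'.prox) (b : A) :
    star ρ (ofProxIso θ) b = ρ (θ b) := by
  rw [ρ.map_sSup (θ b)]
  refine congrArg sSup (Set.ext fun x => ?_)
  simp only [mem_ofPred_eq, θ.surjective.exists, θ.map_rel_iff]
  rfl

theorem ofProxIso_star (θ : A'.prox ≃r A''.prox) (ρ : DeVriesHom A A') (b : A) :
    star (ofProxIso θ) ρ b = θ (ρ b) := by
  change _ = orderIsoOfProxIso θ (ρ b)
  rw [ρ.map_sSup b, sSupHomClass.map_sSup]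
  refine congrArg sSup (Set.ext fun x => ?_)
  simp only [mem_image, mem_ofPred_eq, exists_exists_and_eq_and]
  rfl

end DeVriesHom

theorem zetaIso_naturality (ρ : DeVriesHom A A') : star (.ofProxIso (zetaIso A')) ρ =
    star (upperStarMap (lowerStarMap ρ)) (.ofProxIso (zetaIso A)) := by
  refine DeVriesHom.ext (funext fun b => ?_)
  rw [DeVriesHom.ofProxIso_star, DeVriesHom.star_ofProxIso, upperStarMap_lowerStarMap_zetaIso]

end

namespace DeVriesExtension

/-- An isomorphism of de Vries extensions, from isomorphisms of the two algebras that commute with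
the extensions. -/
def isoMk {a a' : DeVriesExtension.{u}} (θ : a.A.prox ≃r a'.A.prox) (σ : a.B ≃o a'.B)
    (comm : ∀ x : a.A, σ (a.α x) = a'.α (θ x)) : a ≅ a' where
  hom :=
    { ρ := .ofProxIso θ
      σ := CompleteLatticeHom.OrderIso.toCompleteLatticeHom σ
      comm := fun x => (comm x).trans (DeVriesHom.star_ofProxIso a'.α θ x).symm }
  inv :=
    { ρ := .ofProxIso θ.symm
      σ := CompleteLatticeHom.OrderIso.toCompleteLatticeHom σ.symm
      comm := fun x => by
        rw [DeVriesHom.star_ofProxIso]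
        refine σ.symm_apply_eq.2 ?_
        rw [comm, θ.apply_symm_apply] }
  hom_inv_id := Hom.ext
    (DeVriesHom.ext (funext fun x =>
      (DeVriesHom.star_ofProxIso _ θ x).trans (θ.symm_apply_apply x)))
    (DFunLike.ext _ _ σ.symm_apply_apply)
  inv_hom_id := Hom.ext
    (DeVriesHom.ext (funext fun x =>
      (DeVriesHom.star_ofProxIso _ θ.symm x).trans (θ.apply_symm_apply x)))
    (DFunLike.ext _ _ σ.apply_symm_apply)

/-- The representation of `B` as the powerset of its set of atoms, for a de Vries extension
`α : 𝔄 → (B, ≤)`. -/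
def atomSpaceIso (a : DeVriesExtension.{u}) : a.B ≃o Set a.AtomSpace :=
  letI := CompleteBooleanAlgebra.toCompleteAtomicBooleanAlgebra (α := a.B)
  CompleteAtomicBooleanAlgebra.toSetOfIsAtom

/-- The isomorphism `α ≅ E(C(α))`, a component of the counit. -/
noncomputable def isoEC (a : DeVriesExtension.{u}) : a ≅ EObj (CObj a) :=
  isoMk (a' := EObj (CObj a)) (zetaIso a.A) a.atomSpaceIso
    fun b => Set.ext fun x => (a.mem_atomMap x b).symm

theorem isoEC_naturality {a a' : DeVriesExtension.{u}} (φ : a ⟶ a') :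
    φ ≫ (isoEC a').hom = (isoEC a).hom ≫ EMap (CMap φ) :=
  Hom.ext (zetaIso_naturality φ.ρ) (DFunLike.ext _ _ fun b =>
    Set.ext fun x => (sInf_le_iff_le_map φ.σ x.1 b).symm)

end DeVriesExtension

/-! ### The representation of a compact Hausdorff space by ends of regular open sets -/

section

variable {Y Y' : Type u} [TopologicalSpace Y] [CompactSpace Y] [T2Space Y]
  [TopologicalSpace Y'] [CompactSpace Y'] [T2Space Y']

theorem isEnd_setOf_mem (y : Y) : IsEnd (upperStar Y) {U : RO Y | y ∈ U.carrier} := by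
  have hF : IsProperRoundFilter (upperStar Y) {U : RO Y | y ∈ U.carrier} :=
    { top_mem := mem_univ y
      inf_mem := And.intro
      mem_of_le := fun hU hUV => hUV hU
      bot_notMem := fun h => h
      round := Subset.antisymm (fun _ ⟨_, hV, hVU⟩ => hVU (subset_closure hV))
        fun U hU => RO.exists_mem_closure_subset U.isOpen hU }
  refine isEnd_of_prime hF fun (U : RO Y) (V : RO Y) (hUV : closure U.carrier ⊆ V.carrier) => ?_
  by_cases hy : y ∈ closure U.carrier
  · exact Or.inr (hUV hy)
  · left
    change y ∈ interior U.carrierᶜ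
    rwa [interior_compl]

/-- The end of the regular open neighbourhoods of a point, through which a compact Hausdorff space
`Y` is identified with the space of ends of `RO(Y)`. -/
def nhdsEnd (y : Y) : Ends (upperStar Y) := ⟨{U : RO Y | y ∈ U.carrier}, isEnd_setOf_mem y⟩

theorem continuous_nhdsEnd : Continuous (nhdsEnd : Y → Ends (upperStar Y)) := by
  refine continuous_generateFrom_iff.2 ?_
  rintro _ ⟨U, rfl⟩
  exact RO.isOpen U

theorem nhdsEnd_injective : Function.Injective (nhdsEnd : Y → Ends (upperStar Y)) := by
  intro y z h
  by_contra hne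
  obtain ⟨U, hyU, hU⟩ := RO.exists_mem_closure_subset isClosed_singleton.isOpen_compl
    (show y ∈ ({z} : Set Y)ᶜ from hne)
  have hz : U ∈ (nhdsEnd z).1 := h ▸ (show U ∈ (nhdsEnd y).1 from hyU)
  exact hU (subset_closure hz) rfl

theorem denseRange_nhdsEnd : DenseRange (nhdsEnd : Y → Ends (upperStar Y)) := by
  refine (DeVriesExtension.isTopologicalBasis_zeta (upperStar Y)).dense_iff.2 ?_
  rintro _ ⟨U, rfl⟩ ⟨z, hz⟩
  obtain ⟨y, hy⟩ : (RO.carrier U).Nonempty := by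
    by_contra hU
    rw [show U = ⊥ from RO.ext (not_nonempty_iff_eq_empty.1 hU)] at hz
    exact z.2.1.bot_notMem hz
  exact ⟨nhdsEnd y, hy, y, rfl⟩

theorem nhdsEnd_surjective : Function.Surjective (nhdsEnd : Y → Ends (upperStar Y)) := by
  rw [← range_eq_univ, ← denseRange_nhdsEnd.closure_range,
    (isCompact_range continuous_nhdsEnd).isClosed.closure_eq]

/-- The representation of a compact Hausdorff space `Y` as the space of ends of `RO(Y)`. -/
noncomputable def nhdsEndHomeomorph (Y : Type u) [TopologicalSpace Y] [CompactSpace Y] [T2Space Y] :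
    Y ≃ₜ Ends (upperStar Y) :=
  Continuous.homeoOfEquivCompactToT2
    (f := .ofBijective nhdsEnd ⟨nhdsEnd_injective, nhdsEnd_surjective⟩) continuous_nhdsEnd

theorem lowerStar_upperStarMap_nhdsEnd (g : C(Y, Y')) (y : Y) :
    lowerStar (upperStarMap g) (nhdsEnd y) = nhdsEnd (g y) := by
  refine Ends.eq_of_subset ?_
  rintro (U : RO Y') ⟨V, hV, hVU⟩
  exact reg_preimage_subset g hVU hV

end

/-! ### Isomorphisms of compactifications -/

/-- The points of a set, as the atoms of its powerset. -/
noncomputable def singletonEquiv (X : Type*) : X ≃ {s : Set X // IsAtom s} :=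
  .ofBijective (fun x => ⟨{x}, Set.isAtom_singleton x⟩)
    ⟨fun _ _ h => singleton_injective (congrArg Subtype.val h), fun ⟨s, hs⟩ => by
      obtain ⟨x, rfl⟩ := Set.isAtom_iff.1 hs
      exact ⟨x, rfl⟩⟩

theorem lowerPlus_setPreimage_singleton {X X' : Type u} (f : X → X') (x : X) :
    lowerPlus (.setPreimage f) (singletonEquiv X x) = singletonEquiv X' (f x) := by
  refine Subtype.ext (Subset.antisymm (sInter_subset_of_mem ?_) (subset_sInter fun s hs => ?_))
  · exact singleton_subset_iff.2 (mem_singleton (f x))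
  · exact singleton_subset_iff.2 (hs (mem_singleton x))

namespace Compactification

/-- An isomorphism of compactifications, from a homeomorphism `g` of the compact spaces that
restricts to a bijection `f`; since `e` and `e'` are embeddings, `f` is bicontinuous. -/
def isoMk {e e' : Compactification.{u}} (f : e.X ≃ e'.X) (g : e.Y ≃ₜ e'.Y)
    (comm : ∀ x, g (e.e x) = e'.e (f x)) : e ≅ e' :=
  have comm_symm (x : e'.X) : g.symm (e'.e x) = e.e (f.symm x) := by
    rw [g.symm_apply_eq, comm, f.apply_symm_apply]
  { hom :=
      { f := ⟨f, e'.isEmbedding.continuous_iff.2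
          ((g.continuous.comp e.isEmbedding.continuous).congr comm)⟩
        g := g
        comm := comm }
    inv :=
      { f := ⟨f.symm, e.isEmbedding.continuous_iff.2
          ((g.symm.continuous.comp e'.isEmbedding.continuous).congr comm_symm)⟩
        g := g.symm
        comm := comm_symm }
    hom_inv_id := Hom.ext (ContinuousMap.ext f.symm_apply_apply)
      (ContinuousMap.ext g.symm_apply_apply)
    inv_hom_id := Hom.ext (ContinuousMap.ext f.apply_symm_apply)
      (ContinuousMap.ext g.apply_symm_apply) }

/-- The isomorphism `e ≅ C(E(e))`, a component of the unit. -/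
noncomputable def isoCE (e : Compactification.{u}) : e ≅ CObj (EObj e) :=
  isoMk (e' := CObj (EObj e)) (singletonEquiv e.X) (nhdsEndHomeomorph e.Y) fun x =>
    Subtype.ext <| Set.ext fun U =>
      (singleton_subset_iff (s := e.e ⁻¹' RO.carrier U)).symm.trans
        ((EObj e).mem_atomMap (singletonEquiv e.X x) U).symm

theorem isoCE_naturality {e e' : Compactification.{u}} (φ : e ⟶ e') :
    φ ≫ (isoCE e').hom = (isoCE e).hom ≫ CMap (EMap φ) :=
  Hom.ext (ContinuousMap.ext fun x => (lowerPlus_setPreimage_singleton φ.f x).symm)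
    (ContinuousMap.ext fun y => (lowerStar_upperStarMap_nhdsEnd φ.g y).symm)

end Compactification

/-- The unit of the dual equivalence, from the identity of compactifications to `C ∘ E`. -/
noncomputable def unitIso : 𝟭 Compactification.{u}ᵒᵖ ≅ E ⋙ C.rightOp :=
  (NatIso.ofComponents (F := E ⋙ C.rightOp) (G := 𝟭 _) (fun e => e.unop.isoCE.op)
    fun φ => congrArg Quiver.Hom.op (Compactification.isoCE_naturality φ.unop).symm).symm

/-- The counit of the dual equivalence, from `E ∘ C` to the identity of de Vries extensions. -/
noncomputable def counitIso : C.rightOp ⋙ E ≅ 𝟭 DeVriesExtension.{u} :=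
  (NatIso.ofComponents (F := 𝟭 _) (G := C.rightOp ⋙ E) DeVriesExtension.isoEC
    DeVriesExtension.isoEC_naturality).symm

end DeVries

theorem theorem5p5 :
    ∃ F : DeVries.Compactification.{u}ᵒᵖ ≌ DeVries.DeVriesExtension.{u},
      F.functor = DeVries.E ∧ F.inverse = DeVries.C.rightOp := by
  let F : DeVries.Compactification.{u}ᵒᵖ ≌ DeVries.DeVriesExtension.{u} :=
    CategoryTheory.Equivalence.mk DeVries.E DeVries.C.rightOp DeVries.unitIso DeVries.counitIso
  exact ⟨F, rfl, rfl⟩
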